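/- Let $\|\cdot\|_2$ denote the $L_2$ norm with respect to the uniform distribution on $[0,1]$ or on $[0,1]^d$, as appropriate, and let $\sigma, L, K_1, K_2 > 0$, $0 < w < 2$ and an integer $k \ge 0$ be given. There exist constants $c_0, n_0 > 0$, depending only on $\sigma, k, L, K_1, K_2, w$, for which the following holds. Let $J$ be a seminorm on a linear space of functions $g : [0,1] \to \mathbb{R}$ (the domain of $J$), and write $B_J(1) = \{g : J(g) \le 1\}$ and $B_\infty(1) = \{g : \|g\|_\infty \le 1\}$, where $\|\cdot\|_\infty$ is the essential supremum norm. Assume that: (C1) every function in the domain of $J$ is $k$ times weakly differentiable, and the functions $t \mapsto t^\ell$, $\ell = 0, \ldots, k$, belong to the domain and satisfy $J(t^\ell) = 0$; (C2) $\operatorname{ess\,sup}_{t \in [0,1]} g^{(k)}(t) - \operatorname{ess\,inf}_{t \in [0,1]} g^{(k)}(t) \le L$ for all $g \in B_J(1)$, with $g^{(k)}$ the $k$th weak derivative of $g$; (C4) with $S = B_J(1) \cap B_\infty(1)$, $$\log M(\delta, \|\cdot\|_2, S) \ge K_1 \delta^{-w} \ \text{ for all } 0 < \delta \le 1, \qquad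 \log N(\delta, \|\cdot\|_2, S) \le K_2 \delta^{-w} \ \text{ for all } \delta > 0,$$ where $M(\delta, \|\cdot\|_2, S)$ is the largest number of points of $S$ at pairwise $\|\cdot\|_2$-distance greater than $\delta$, and $N(\delta, \|\cdot\|_2, S)$ is the smallest number of $\|\cdot\|_2$-balls of radius $\delta$ that cover $S$. For an integer $d \ge 1$ and $c > 0$ let $B_J^d(c)$ be the set of functions $x \mapsto \sum_{j=1}^d f_j(x_j)$ on $[0,1]^d$ with $J(f_j) \le c$ for $j = 1, \ldots, d$. Consider data $(X^i, Y^i)$, $i = 1, \ldots, n$, where the inputs $X^i$ are i.i.d. uniform on $[0,1]^d$ and $$Y^i = \mu + f_0(X^i) + \epsilon^i, \qquad i = 1, \ldots, n,$$ with $\mu \in \mathbb{R}$ and $\epsilon^1, \ldots, \epsilon^n$ i.i.d. $N(0, \sigma^2)$, independent of the inputs. Then for all $d \ge 1$, all $\mu \in \mathbb{R}$, all $c_n \ge 1$ and all $n \ge n_0 d^{1+w/2} c_n^w$, $$\inf_{\hat f}\ \sup_{f_0 \in B_J^d(c_n),\ \int_{[0,1]^d} f_0(x)\,dx = 0} \mathbb{E}\,\|\hat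 f - f_0\|_2^2 \ \ge\ c_0\, d\, n^{-2/(2+w)} c_n^{2w/(2+w)},$$ where the infimum is over all measurable estimators $\hat f$ based on the data $(X^i, Y^i)$, $i = 1, \ldots, n$ (they may depend on $\mu$, $\sigma$, $J$, $d$ and $c_n$). -/

import Mathlib

open MeasureTheory ProbabilityTheory Set
open scoped ENNReal NNReal ContDiff

noncomputable section

namespace AdditiveMinimax

/-- `h` is a weak derivative of order `l` of `g` on the open interval `(0, 1)`: both are locally
integrable there, and integration by parts holds against every smooth function compactly supported
in `(0, 1)`. -/
def IsWeakDeriv (l : ℕ) (g h : unitInterval → ℝ) : Prop :=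
  LocallyIntegrableOn g (Ioo (0 : unitInterval) 1) volume ∧
  LocallyIntegrableOn h (Ioo (0 : unitInterval) 1) volume ∧
  ∀ φ : ℝ → ℝ, ContDiff ℝ ∞ φ → HasCompactSupport φ → tsupport φ ⊆ Ioo (0 : ℝ) 1 →
    ∫ t : unitInterval, g t * iteratedDeriv l φ (t : ℝ) =
      (-1) ^ l * ∫ t : unitInterval, h t * φ (t : ℝ)

/-- `g` is `k` times weakly differentiable. -/
def WeaklyDifferentiable (k : ℕ) (g : unitInterval → ℝ) : Prop :=
  ∀ l ≤ k, ∃ h : unitInterval → ℝ, IsWeakDeriv l g h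

/-- A regularizer is a seminorm `J` on a linear space `V` of functions on `[0, 1]` (its domain).
Its domain consists of `k` times weakly differentiable functions, and all the monomials `t ^ l`,
`l ≤ k`, lie in the domain and in the null space. -/
def NullPolynomials (k : ℕ) (V : Submodule ℝ (unitInterval → ℝ)) (J : Seminorm ℝ V) : Prop :=
  (∀ g ∈ V, WeaklyDifferentiable k g) ∧
  ∀ l ≤ k, ∃ hl : (fun t : unitInterval => (t : ℝ) ^ l) ∈ V,
    J ⟨fun t : unitInterval => (t : ℝ) ^ l, hl⟩ = 0

/-- `ess sup g⁽ᵏ⁾ - ess inf g⁽ᵏ⁾ ≤ L` for all `g` with `J g ≤ 1`, where the essential supremum and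
infimum are extended real numbers. -/
def BoundedDerivs (k : ℕ) (L : ℝ) (V : Submodule ℝ (unitInterval → ℝ)) (J : Seminorm ℝ V) : Prop :=
  ∀ g : V, J g ≤ 1 → ∀ h : unitInterval → ℝ, IsWeakDeriv k g h →
    essSup (fun t => (h t : EReal)) volume - essInf (fun t => (h t : EReal)) volume ≤ (L : EReal)

/-- The set of functions `g` with `J g ≤ 1` and `‖g‖_∞ ≤ 1`, as a subset of `L²([0, 1])`. -/
def unitBall (V : Submodule ℝ (unitInterval → ℝ)) (J : Seminorm ℝ V) :
    Set (Lp ℝ 2 (volume : Measure unitInterval)) :=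
  {u | ∃ g : V, J g ≤ 1 ∧ eLpNorm (g : unitInterval → ℝ) ∞ volume ≤ 1 ∧
    (u : unitInterval → ℝ) =ᵐ[volume] (g : unitInterval → ℝ)}

/-- Matching bounds on the log packing and log covering numbers of `unitBall V J` in the `L²` norm:
`log M(δ) ≥ K₁ δ ^ (-w)` and `log N(δ) ≤ K₂ δ ^ (-w)`. The packing number is the largest
cardinality of a subset whose points have pairwise distances exceeding `δ`; it equals `1` for large
`δ`, so that the lower bound is required for `0 < δ ≤ 1`. The covering number is the least number of
balls of radius `δ`, with arbitrary centres, that cover the set. -/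
def MatchingEntropy (w K₁ K₂ : ℝ) (V : Submodule ℝ (unitInterval → ℝ)) (J : Seminorm ℝ V) : Prop :=
  (∀ δ : ℝ≥0, 0 < δ → δ ≤ 1 →
    ((K₁ * (δ : ℝ) ^ (-w) : ℝ) : EReal)
      ≤ ENNReal.log (Metric.packingNumber δ (unitBall V J) : ℝ≥0∞)) ∧
  (∀ δ : ℝ≥0, 0 < δ →
    ENNReal.log (Metric.externalCoveringNumber δ (unitBall V J) : ℝ≥0∞)
      ≤ ((K₂ * (δ : ℝ) ^ (-w) : ℝ) : EReal))

/-- The additive functions `x ↦ ∑ j, f j (x j)` on `[0, 1] ^ d` with `J (f j) ≤ c` for all `j`. -/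
def additiveClass (V : Submodule ℝ (unitInterval → ℝ)) (J : Seminorm ℝ V) (d : ℕ) (c : ℝ) :
    Set ((Fin d → unitInterval) → ℝ) :=
  {f | ∃ g : Fin d → V, (∀ j, J (g j) ≤ c) ∧ f = fun x => ∑ j, (g j : unitInterval → ℝ) (x j)}

/-- The functions in `additiveClass V J d c` with integral zero over `[0, 1] ^ d`. -/
def centeredClass (V : Submodule ℝ (unitInterval → ℝ)) (J : Seminorm ℝ V) (d : ℕ) (c : ℝ) :
    Set ((Fin d → unitInterval) → ℝ) :=
  {f | f ∈ additiveClass V J d c ∧ ∫ x, f x = 0}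

/-- The joint law of the inputs and the errors: `n` independent inputs, uniform on `[0, 1] ^ d`, and,
independent of them, `n` independent errors with law `N(0, σ²)`. -/
def sampleLaw (σ : ℝ) (d n : ℕ) : Measure ((Fin n → Fin d → unitInterval) × (Fin n → ℝ)) :=
  (Measure.pi fun _ : Fin n => (volume : Measure (Fin d → unitInterval))).prod
    (Measure.pi fun _ : Fin n => gaussianReal 0 (Real.toNNReal (σ ^ 2)))

/-- The responses `Y i = μ + f (X i) + ε i`. -/
def response {d n : ℕ} (μ : ℝ) (f : (Fin d → unitInterval) → ℝ)
    (X : Fin n → Fin d → unitInterval) (ε : Fin n → ℝ) :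
    Fin n → ℝ :=
  fun i => μ + f (X i) + ε i

/-- An estimator maps the data `(X, Y)` to a function on `[0, 1] ^ d`. -/
abbrev Estimator (d n : ℕ) : Type :=
  (Fin n → Fin d → unitInterval) × (Fin n → ℝ) → (Fin d → unitInterval) → ℝ

/-- The risk `𝔼 ‖fhat - f‖₂²` of an estimator `fhat` when the regression function is `μ + f`. -/
def risk (σ μ : ℝ) {d n : ℕ} (fhat : Estimator d n) (f : (Fin d → unitInterval) → ℝ) : ℝ≥0∞ :=
  ∫⁻ p, eLpNorm (fun x => fhat (p.1, response μ f p.1 p.2) x - f x) 2 volume ^ 2 ∂(sampleLaw σ d n)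

/-- The minimax risk over a class of regression functions; the infimum is over all (jointly
measurable) estimators. -/
def minimaxRisk (σ μ : ℝ) (d n : ℕ) (F : Set ((Fin d → unitInterval) → ℝ)) : ℝ≥0∞ :=
  ⨅ (fhat : Estimator d n) (_ : Measurable (Function.uncurry fhat)), ⨆ f ∈ F, risk σ μ fhat f

end AdditiveMinimax

end

/-!
The proof is a Fano argument over a finite set of regression functions `x ↦ ∑ j, c * γ (θ j) (x j)`,
where `γ` runs through a finite set of functions on `[0, 1]` and `θ` through a code.

*The one-dimensional functions.* The two entropy bounds have the same order, so for a large constant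
`C` the packing number of the unit ball at scale `δ` exceeds its covering number at scale `C δ` by a
factor exponential in `δ ^ (-w)`. By the pigeonhole principle one ball of radius `C δ` contains
`exp (κ δ ^ (-w))` functions that are `δ`-separated and whose means nearly agree; since constants lie
in the null space of `J`, the means can be subtracted (`exists_centered_packing`).

*The code.* A Gilbert–Varshamov code over the alphabet of these functions has words `θ` differing in
at least half of the `d` coordinates, and the logarithm of its size is of order `d δ ^ (-w)`
(`exists_code`). As centred functions of distinct coordinates are orthogonal
(`lintegral_sq_sum_eval`), the regression functions have pairwise squared distances of exact order
`d c ^ 2 δ ^ 2`.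

*Testing.* The law of the data under one regression function is transferred to that under another by
an explicit Gaussian change of measure (`sampleLaw_shift_le`), whose likelihood ratio is controlled
by Markov's inequality in terms of `n ∫ h ^ 2 / (2 σ ^ 2)`, with `h` the difference of the two
functions. Since the events that the estimator is close to the various regression functions are
disjoint, they cannot all have probability at least `1 / 2` (`exists_le_risk`).

The scale `δ` balances the divergence `n c ^ 2 δ ^ 2` against the entropy `δ ^ (-w)`, and the risk
is then of order `d c ^ 2 δ ^ 2`.
-/

open MeasureTheory ProbabilityTheory Set
open scoped ENNReal NNReal ContDiff

namespace AdditiveMinimax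

/-! ### Gaussian shifts and Fano's inequality -/

lemma pi_withDensity_prod {ι : Type*} [Fintype ι] {G : Measure ℝ} [IsProbabilityMeasure G]
    {ρ : ι → ℝ → ℝ≥0∞} (hρ : ∀ i, Measurable (ρ i)) [∀ i, SigmaFinite (G.withDensity (ρ i))] :
    Measure.pi (fun i => G.withDensity (ρ i)) =
      (Measure.pi fun _ : ι => G).withDensity (fun u => ∏ i, ρ i (u i)) := by
  refine Measure.pi_eq fun s hs => ?_
  rw [withDensity_apply _ (MeasurableSet.univ_pi hs), ← lintegral_indicator (MeasurableSet.univ_pi hs)]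
  have h1 : (univ.pi s).indicator (fun u : ι → ℝ => ∏ i, ρ i (u i)) =
      fun u => ∏ i, (s i).indicator (ρ i) (u i) := by
    ext u
    by_cases hu : u ∈ univ.pi s
    · rw [indicator_of_mem hu]
      exact Finset.prod_congr rfl fun i _ => (indicator_of_mem (hu i (mem_univ i)) _).symm
    · rw [indicator_of_notMem hu]
      simp only [mem_pi, mem_univ, true_imp_iff, not_forall] at hu
      obtain ⟨i, hi⟩ := hu
      exact (Finset.prod_eq_zero (Finset.mem_univ i) (indicator_of_notMem hi _)).symm
  have hm : ∀ i, Measurable ((s i).indicator (ρ i)) := fun i => (hρ i).indicator (hs i)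
  have hind : iIndepFun (fun i (u : ι → ℝ) => (s i).indicator (ρ i) (u i))
      (Measure.pi fun _ : ι => G) := iIndepFun_pi fun i => (hm i).aemeasurable
  rw [h1, lintegral_prod_eq_prod_lintegral_of_indepFun Finset.univ _ hind
    fun i => (hm i).comp (measurable_pi_apply i)]
  refine Finset.prod_congr rfl fun i _ => ?_
  rw [withDensity_apply _ (hs i), ← lintegral_indicator (hs i)]
  exact (measurePreserving_eval (fun _ : ι => G) i).lintegral_comp (hm i)

lemma gaussianReal_map_add_eq_withDensity {v : ℝ≥0} (hv : v ≠ 0) (m : ℝ) :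
    (gaussianReal 0 v).map (· + m) =
      (gaussianReal 0 v).withDensity
        (fun x => ENNReal.ofReal (Real.exp ((m * x - m ^ 2 / 2) / v))) := by
  have hv' : (v : ℝ) ≠ 0 := by exact_mod_cast hv
  rw [gaussianReal_map_add_const, zero_add, gaussianReal_of_var_ne_zero _ hv,
    gaussianReal_of_var_ne_zero _ hv, ← withDensity_mul _ (by fun_prop) (by fun_prop)]
  congr 1
  ext x
  simp only [Pi.mul_apply, gaussianPDF, gaussianPDFReal]
  rw [← ENNReal.ofReal_mul (by positivity), mul_assoc _ (Real.exp _) (Real.exp _), ← Real.exp_add]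
  congr 3
  field_simp
  ring

lemma pi_gaussianReal_map_add {ι : Type*} [Fintype ι] {v : ℝ≥0} (hv : v ≠ 0) (a : ι → ℝ) :
    (Measure.pi fun _ : ι => gaussianReal 0 v).map (· + a) =
      (Measure.pi fun _ : ι => gaussianReal 0 v).withDensity
        (fun u => ENNReal.ofReal (Real.exp (∑ i, (a i * u i - a i ^ 2 / 2) / v))) := by
  have h0 : (fun u : ι → ℝ => u + a) = fun u i => u i + a i := rfl
  have hprob : ∀ i, IsProbabilityMeasure ((gaussianReal 0 v).map (· + a i)) := fun i =>
    Measure.isProbabilityMeasure_map (by fun_prop)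
  rw [h0, Measure.pi_map_pi (f := fun i x => x + a i) (fun i => by fun_prop)]
  have h1 := fun i => gaussianReal_map_add_eq_withDensity hv (a i)
  have : ∀ i, SigmaFinite ((gaussianReal 0 v).withDensity
        (fun x => ENNReal.ofReal (Real.exp ((a i * x - a i ^ 2 / 2) / v)))) := fun i => by
    rw [← h1 i]; infer_instance
  simp_rw [h1]
  rw [pi_withDensity_prod (fun i => by fun_prop)]
  congr 1
  ext u
  rw [Real.exp_sum, ENNReal.ofReal_prod_of_nonneg fun i _ => (Real.exp_pos _).le]

/-- Change of measure for a shifted Gaussian vector. The log-likelihood ratio of the shifted law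
exceeds `t` with probability at most `exp (-t / 2)`, provided that its mean under the shifted law,
`∑ i, a i ^ 2 / (2 v)`, is at most `t / 4`. -/
lemma pi_gaussianReal_shift_le {ι : Type*} [Fintype ι] {v : ℝ≥0} (hv : v ≠ 0) (a : ι → ℝ)
    {t : ℝ} (ha : (∑ i, a i ^ 2) / (2 * v) ≤ t / 4) {A : Set (ι → ℝ)} (hA : MeasurableSet A) :
    (Measure.pi fun _ : ι => gaussianReal 0 v) ((· + a) ⁻¹' A) ≤
      ENNReal.ofReal (Real.exp t) * (Measure.pi fun _ : ι => gaussianReal 0 v) A +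
        ENNReal.ofReal (Real.exp (-t / 2)) := by
  set γ := Measure.pi fun _ : ι => gaussianReal 0 v
  have hv' : (0 : ℝ) < v := by positivity
  set l : (ι → ℝ) → ℝ := fun u => ∑ i, (a i * u i - a i ^ 2 / 2) / v with hl
  have hlm : Measurable l := by fun_prop
  have hmap : γ.map (· + a) = γ.withDensity (fun u => ENNReal.ofReal (Real.exp (l u))) :=
    pi_gaussianReal_map_add hv a
  have hB : MeasurableSet {u | l u ≤ t} := measurableSet_le hlm measurable_const
  have hadd : Measurable (fun u : ι → ℝ => u + a) := by fun_prop
  have hsplit : (· + a) ⁻¹' A ⊆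
      ((· + a) ⁻¹' (A ∩ {u | l u ≤ t})) ∪ {u | ENNReal.ofReal (Real.exp (t / 2)) ≤
        ENNReal.ofReal (Real.exp (l u))} := by
    intro u hu
    by_cases h : l (u + a) ≤ t
    · exact Or.inl ⟨hu, h⟩
    · right
      refine ENNReal.ofReal_le_ofReal (Real.exp_le_exp.2 ?_)
      have : l (u + a) = l u + 2 * ((∑ i, a i ^ 2) / (2 * v)) := by
        simp only [hl, Pi.add_apply]
        rw [Finset.sum_div, Finset.mul_sum, ← Finset.sum_add_distrib]
        refine Finset.sum_congr rfl fun i _ => ?_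
        field_simp
        ring
      linarith [not_le.1 h]
  refine (measure_mono hsplit).trans ((measure_union_le _ _).trans (add_le_add ?_ ?_))
  · rw [← Measure.map_apply hadd (hA.inter hB), hmap, withDensity_apply _ (hA.inter hB)]
    calc ∫⁻ u in A ∩ {u | l u ≤ t}, ENNReal.ofReal (Real.exp (l u)) ∂γ
        ≤ ∫⁻ _ in A ∩ {u | l u ≤ t}, ENNReal.ofReal (Real.exp t) ∂γ :=
          setLIntegral_mono measurable_const fun u hu =>
            ENNReal.ofReal_le_ofReal (Real.exp_le_exp.2 hu.2)
      _ = ENNReal.ofReal (Real.exp t) * γ (A ∩ {u | l u ≤ t}) := by simp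
      _ ≤ _ := by gcongr; exact inter_subset_left
  · have hone : ∫⁻ u, ENNReal.ofReal (Real.exp (l u)) ∂γ = 1 := by
      have : (γ.map (· + a)) univ = 1 := by
        rw [Measure.map_apply hadd MeasurableSet.univ]; simp [γ]
      rwa [hmap, withDensity_apply _ MeasurableSet.univ, Measure.restrict_univ] at this
    have hmk := meas_ge_le_lintegral_div (μ := γ)
      (f := fun u => ENNReal.ofReal (Real.exp (l u))) (by fun_prop)
      (ε := ENNReal.ofReal (Real.exp (t / 2))) (by simp [Real.exp_pos]) ENNReal.ofReal_ne_top
    rw [hone, one_div, ← ENNReal.ofReal_inv_of_pos (Real.exp_pos _), ← Real.exp_neg] at hmk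
    rwa [neg_div]

/-- Transfer of the law of `(X, ε + h X)` to the law of `(X, ε)`: up to small errors, the
former is at most `exp t` times the latter, when `t` is large compared to the Kullback–Leibler
divergence `n ∫ h ^ 2 / (2 σ ^ 2)`. -/
lemma sampleLaw_shift_le {σ : ℝ} (hσ : 0 < σ) {d n : ℕ} {h : (Fin d → unitInterval) → ℝ}
    (hh : Measurable h) {t : ℝ} (ht : 0 < t)
    {A : Set ((Fin n → Fin d → unitInterval) × (Fin n → ℝ))} (hA : MeasurableSet A) :
    sampleLaw σ d n {p | (p.1, fun i => p.2 i + h (p.1 i)) ∈ A} ≤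
      ENNReal.ofReal (Real.exp t) * sampleLaw σ d n A + ENNReal.ofReal (Real.exp (-t / 2)) +
        ENNReal.ofReal (2 / (σ ^ 2 * t)) * (n * ∫⁻ x, ENNReal.ofReal (h x ^ 2)) := by
  set v : ℝ≥0 := Real.toNNReal (σ ^ 2) with hvdef
  have hvσ : (v : ℝ) = σ ^ 2 := Real.coe_toNNReal _ (by positivity)
  have hv : v ≠ 0 := by
    intro h0
    rw [h0, NNReal.coe_zero] at hvσ
    exact (pow_pos hσ 2).ne hvσ
  set γ := Measure.pi fun _ : Fin n => gaussianReal 0 v with hγ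
  set ρ := Measure.pi fun _ : Fin n => (volume : Measure (Fin d → unitInterval)) with hρ
  have hlaw : sampleLaw σ d n = ρ.prod γ := rfl
  have hmeas : Measurable fun p : (Fin n → Fin d → unitInterval) × (Fin n → ℝ) =>
      ((p.1, fun i => p.2 i + h (p.1 i)) : (Fin n → Fin d → unitInterval) × (Fin n → ℝ)) := by
    fun_prop
  have hpt : ∀ X : Fin n → Fin d → unitInterval,
      γ (Prod.mk X ⁻¹' {p | (p.1, fun i => p.2 i + h (p.1 i)) ∈ A}) ≤
        ENNReal.ofReal (Real.exp t) * γ (Prod.mk X ⁻¹' A) + ENNReal.ofReal (Real.exp (-t / 2)) +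
        ENNReal.ofReal (2 / (σ ^ 2 * t)) * ∑ i, ENNReal.ofReal (h (X i) ^ 2) := by
    intro X
    by_cases hX : (∑ i, h (X i) ^ 2) / (2 * v) ≤ t / 4
    · exact (pi_gaussianReal_shift_le hv (fun i => h (X i)) hX
        (measurable_prodMk_left hA)).trans le_self_add
    · refine (prob_le_one).trans (le_trans ?_ le_add_self)
      rw [← ENNReal.ofReal_sum_of_nonneg fun i _ => sq_nonneg _,
        ← ENNReal.ofReal_mul (by positivity), ENNReal.one_le_ofReal]
      rw [not_le, hvσ, lt_div_iff₀ (by positivity)] at hX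
      rw [div_mul_eq_mul_div, one_le_div (by positivity)]
      linarith
  have hA' : MeasurableSet {p : (Fin n → Fin d → unitInterval) × (Fin n → ℝ) |
      (p.1, fun i => p.2 i + h (p.1 i)) ∈ A} := hmeas hA
  rw [hlaw, Measure.prod_apply hA', Measure.prod_apply hA]
  refine (lintegral_mono hpt).trans (le_of_eq ?_)
  have hAm : Measurable fun X => γ (Prod.mk X ⁻¹' A) := measurable_measure_prodMk_left hA
  have hcoord : ∀ i : Fin n, ∫⁻ X, ENNReal.ofReal (h (X i) ^ 2) ∂ρ =
      ∫⁻ x, ENNReal.ofReal (h x ^ 2) := fun i =>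
    (measurePreserving_eval (fun _ : Fin n => (volume : Measure (Fin d → unitInterval)))
      i).lintegral_comp (f := fun x => ENNReal.ofReal (h x ^ 2)) (by fun_prop)
  rw [lintegral_add_right _ (by fun_prop), lintegral_add_right _ (by fun_prop),
    lintegral_const_mul _ hAm, lintegral_const_mul _ (by fun_prop), lintegral_const,
    lintegral_finsetSum _ (fun i _ => by fun_prop)]
  simp only [hcoord]
  simp [hρ]

instance (σ : ℝ) (d n : ℕ) : IsProbabilityMeasure (sampleLaw σ d n) := by
  unfold sampleLaw; infer_instance

/-- A version of Fano's inequality: among at least `4096` regression functions, pairwise at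
distance at least `s`, whose squared distance to a fixed one of them is at most a small multiple of
`σ ^ 2 / n` times the logarithm of their number, every estimator has risk at least
`(s / 2) ^ 2 / 2` at one of them. -/
lemma exists_le_risk {σ : ℝ} (hσ : 0 < σ) (μ : ℝ) {d n : ℕ} {ι : Type*} [Fintype ι]
    {f : ι → (Fin d → unitInterval) → ℝ} (hf : ∀ i, Measurable (f i)) (i₀ : ι) {s : ℝ≥0∞}
    (hs : Pairwise fun i j => s ≤ eLpNorm (fun x => f i x - f j x) 2 volume) {H : ℝ}
    (hH : ∀ i, ∫⁻ x, ENNReal.ofReal ((f i x - f i₀ x) ^ 2) ≤ ENNReal.ofReal H)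
    (hN : 4096 ≤ Fintype.card ι) (hlog : 16 * n * H / σ ^ 2 ≤ Real.log (Fintype.card ι))
    {fhat : Estimator d n} (hfhat : Measurable (Function.uncurry fhat)) :
    ∃ i, (s / 2) ^ 2 / 2 ≤ risk σ μ fhat (f i) := by
  by_contra! hlt
  set N := Fintype.card ι
  set P := sampleLaw σ d n
  -- The responses are recentred at `μ + f i₀`, so that they are pure noise under `f i₀`.
  set D : (Fin n → Fin d → unitInterval) × (Fin n → ℝ) → (Fin d → unitInterval) → ℝ :=
    fun p => fhat (p.1, response μ (f i₀) p.1 p.2) with hD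
  have hDm : Measurable (Function.uncurry D) := by
    have h1 : Measurable fun q : ((Fin n → Fin d → unitInterval) × (Fin n → ℝ)) ×
        (Fin d → unitInterval) => ((q.1.1, response μ (f i₀) q.1.1 q.1.2), q.2) := by
      unfold response
      have := hf i₀
      fun_prop
    exact hfhat.comp h1
  have hDm' : ∀ p, Measurable (D p) := fun p => hDm.comp measurable_prodMk_left
  set E : ι → (Fin n → Fin d → unitInterval) × (Fin n → ℝ) → ℝ≥0∞ :=
    fun i p => eLpNorm (fun x => D p x - f i x) 2 volume with hE
  have hEm : ∀ i, Measurable (E i) := by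
    intro i
    simp only [hE]
    simp_rw [eLpNorm_eq_lintegral_rpow_enorm_toReal (p := 2) two_ne_zero ENNReal.ofNat_ne_top]
    refine Measurable.pow_const (Measurable.lintegral_prod_right' (f := fun q :
      ((Fin n → Fin d → unitInterval) × (Fin n → ℝ)) × (Fin d → unitInterval) =>
        ‖Function.uncurry D q - f i q.2‖ₑ ^ (2 : ℝ≥0∞).toReal) ?_) _
    exact ((hDm.sub ((hf i).comp measurable_snd)).enorm).pow_const _
  set A : ι → Set ((Fin n → Fin d → unitInterval) × (Fin n → ℝ)) :=
    fun i => {p | E i p < s / 2} with hA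
  have hAm : ∀ i, MeasurableSet (A i) := fun i => measurableSet_lt (hEm i) measurable_const
  have hdisj : Pairwise (Function.onFun Disjoint A) := by
    intro i j hij
    refine Set.disjoint_left.2 fun p hi hj => ?_
    refine (hs hij).not_gt ?_
    have h1 : (fun x => f i x - f j x) = (fun x => f i x - D p x) + fun x => D p x - f j x := by
      ext x; simp
    have h2 : eLpNorm (fun x => f i x - D p x) 2 volume = E i p :=
      eLpNorm_sub_comm (f i) (D p) 2 volume
    calc eLpNorm (fun x => f i x - f j x) 2 volume ≤ E i p + E j p := by
          rw [h1, ← h2]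
          exact eLpNorm_add_le ((hf i).sub (hDm' p)).aestronglyMeasurable
            ((hDm' p).sub (hf j)).aestronglyMeasurable (by norm_num)
      _ < s / 2 + s / 2 := ENNReal.add_lt_add hi hj
      _ = s := ENNReal.add_halves s
  set T : ι → (Fin n → Fin d → unitInterval) × (Fin n → ℝ) →
      (Fin n → Fin d → unitInterval) × (Fin n → ℝ) :=
    fun i p => (p.1, fun k => p.2 k + (f i (p.1 k) - f i₀ (p.1 k))) with hT
  have hTm : ∀ i, Measurable (T i) := by
    intro i
    have := hf i
    have := hf i₀
    fun_prop
  have hrisk : ∀ i, risk σ μ fhat (f i) = ∫⁻ p, E i (T i p) ^ 2 ∂P := by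
    intro i
    have : ∀ p : (Fin n → Fin d → unitInterval) × (Fin n → ℝ),
        response μ (f i) p.1 p.2 = response μ (f i₀) (T i p).1 (T i p).2 := by
      intro p
      ext k
      simp only [response, hT]
      ring
    simp only [risk, this]
    rfl
  have hsucc : ∀ i, (1 / 2 : ℝ≥0∞) ≤ P (T i ⁻¹' A i) := by
    intro i
    have h1 : (s / 2) ^ 2 * P ((T i ⁻¹' A i)ᶜ) ≤ risk σ μ fhat (f i) := by
      rw [hrisk]
      have h2 := mul_meas_ge_le_lintegral (μ := P) (((hEm i).comp (hTm i)).pow_const 2)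
        ((s / 2) ^ 2)
      refine le_trans (mul_le_mul_right (measure_mono ?_) _) h2
      intro p hp
      have : s / 2 ≤ E i (T i p) := not_lt.1 hp
      simp only [mem_ofPred_eq, Function.comp]
      gcongr
    have h3 : P ((T i ⁻¹' A i)ᶜ) < 1 / 2 := by
      have := h1.trans_lt (hlt i)
      rw [div_eq_mul_inv ((s / 2) ^ 2), ← one_div] at this
      exact lt_of_mul_lt_mul_left' this
    rw [prob_compl_eq_one_sub (hTm i (hAm i))] at h3
    by_contra! h4
    have h5 : (1 : ℝ≥0∞) ≤ (1 - P (T i ⁻¹' A i)) + P (T i ⁻¹' A i) := le_tsub_add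
    exact (h5.trans_lt (ENNReal.add_lt_add h3 h4)).ne (ENNReal.add_halves 1).symm
  have hNR : (4096 : ℝ) ≤ N := by exact_mod_cast hN
  have hlogpos : 0 < Real.log N := Real.log_pos (by linarith)
  -- With `t = log N / 2` and `e = N ^ (1 / 4)`, summing the transfer bound over the disjoint events
  -- `A i` gives `N / 2 ≤ e ^ 2 + e ^ 3 + N / 4`, which is false for `e ≥ 8`.
  set t := Real.log N / 2 with ht
  have htpos : 0 < t := by positivity
  set e := Real.exp (t / 2) with he
  have he4 : e ^ 4 = N := by
    rw [he, ← Real.exp_nat_mul, ht]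
    rw [show ((4 : ℕ) : ℝ) * (Real.log N / 2 / 2) = Real.log N by push_cast; ring]
    exact Real.exp_log (by linarith)
  have hepos : 0 < e := Real.exp_pos _
  have he8 : 8 ≤ e := by
    by_contra! h
    have : e ^ 4 < 8 ^ 4 := by gcongr
    rw [he4] at this
    norm_num at this
    linarith
  have hexpt : Real.exp t = e ^ 2 := by
    rw [he, ← Real.exp_nat_mul]; congr 1; push_cast; ring
  have hexpt' : Real.exp (-t / 2) = 1 / e := by
    rw [he, neg_div, Real.exp_neg, one_div]
  have hquarter : 2 / (σ ^ 2 * t) * (n * H) ≤ 1 / 4 := by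
    rw [ht]
    rw [div_le_iff₀ (by positivity)] at hlog
    rw [div_mul_eq_mul_div, div_le_iff₀ (by positivity)]
    linarith
  have hbound : ∀ i, (1 / 2 : ℝ) ≤ e ^ 2 * (P (A i)).toReal + 1 / e + 1 / 4 := by
    intro i
    have h1 := (hsucc i).trans (sampleLaw_shift_le hσ ((hf i).sub (hf i₀)) htpos (hAm i))
    have h2 : ENNReal.ofReal (2 / (σ ^ 2 * t)) *
        (n * ∫⁻ x, ENNReal.ofReal ((f i - f i₀) x ^ 2)) ≤ ENNReal.ofReal (1 / 4) := by
      calc _ ≤ ENNReal.ofReal (2 / (σ ^ 2 * t)) * (n * ENNReal.ofReal H) := by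
            gcongr; exact hH i
        _ = ENNReal.ofReal (2 / (σ ^ 2 * t) * (n * H)) := by
            rw [← ENNReal.ofReal_natCast, ← ENNReal.ofReal_mul (by positivity),
              ← ENNReal.ofReal_mul (by positivity)]
        _ ≤ _ := ENNReal.ofReal_le_ofReal hquarter
    have h3 := h1.trans (add_le_add_right h2 _)
    rw [hexpt, hexpt', ← ENNReal.ofReal_toReal (measure_ne_top P (A i)),
      ← ENNReal.ofReal_mul (by positivity), ← ENNReal.ofReal_add (by positivity) (by positivity),
      ← ENNReal.ofReal_add (by positivity) (by positivity)] at h3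
    have h4 := ENNReal.toReal_mono ENNReal.ofReal_ne_top h3
    rw [ENNReal.toReal_ofReal (by positivity)] at h4
    simpa using h4
  have hsumA : ∑ i, (P (A i)).toReal ≤ 1 := by
    rw [← ENNReal.toReal_sum fun i _ => measure_ne_top P _]
    refine ENNReal.toReal_le_of_le_ofReal zero_le_one ?_
    rw [← measure_biUnion_finset (fun i _ j _ hij => hdisj hij) fun i _ => hAm i]
    simpa using prob_le_one
  have hsum : ∑ _i : ι, (1 / 2 : ℝ) ≤ ∑ i, (e ^ 2 * (P (A i)).toReal + 1 / e + 1 / 4) :=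
    Finset.sum_le_sum fun i _ => hbound i
  rw [Finset.sum_add_distrib, Finset.sum_add_distrib, ← Finset.mul_sum] at hsum
  simp only [Finset.sum_const, Finset.card_univ, nsmul_eq_mul] at hsum
  change (N : ℝ) * _ ≤ _ + N * _ + N * _ at hsum
  rw [← he4] at hsum
  have h5 : e ^ 4 * (1 / e) = e ^ 3 := by field_simp
  rw [h5] at hsum
  nlinarith [mul_le_mul_of_nonneg_left hsumA (sq_nonneg e), mul_le_mul_of_nonneg_left he8
    (pow_nonneg hepos.le 3), mul_le_mul_of_nonneg_left he8 (pow_nonneg hepos.le 2)]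

/-! ### Local packings from global entropy -/

lemma exists_finset_isSeparated {X : Type*} [PseudoEMetricSpace X] {δ : ℝ≥0} {A : Set X} {m : ℕ}
    (h : (m : ℕ∞) < Metric.packingNumber δ A) :
    ∃ F : Finset X, ↑F ⊆ A ∧ Metric.IsSeparated δ (F : Set X) ∧ F.card = m + 1 := by
  simp only [Metric.packingNumber, lt_iSup_iff] at h
  obtain ⟨S, hSA, hS, hm⟩ := h
  obtain ⟨T, hTS, hT⟩ := Set.exists_subset_encard_eq (s := S) (k := ((m + 1 : ℕ) : ℕ∞))
    (by push_cast; exact Order.add_one_le_of_lt hm)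
  have hfin : T.Finite := Set.finite_of_encard_eq_coe hT
  refine ⟨hfin.toFinset, by simpa using hTS.trans hSA, ?_, ?_⟩
  · rw [hfin.coe_toFinset]
    exact hS.mono hTS
  rw [hfin.encard_eq_coe_toFinset_card] at hT
  exact_mod_cast hT

lemma exists_finset_isCover {X : Type*} [PseudoEMetricSpace X] {ε : ℝ≥0} {A : Set X} {N : ℕ}
    (h : Metric.externalCoveringNumber ε A ≤ N) :
    ∃ F : Finset X, Metric.IsCover ε A F ∧ F.card ≤ N := by
  have h' : Metric.externalCoveringNumber ε A < (N + 1 : ℕ) :=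
    h.trans_lt (by exact_mod_cast Nat.lt_succ_self N)
  simp only [Metric.externalCoveringNumber, iInf_lt_iff] at h'
  obtain ⟨S, hS, hN⟩ := h'
  have hfin : S.Finite := Set.encard_lt_top_iff.1 (hN.trans (ENat.natCast_lt_top _))
  refine ⟨hfin.toFinset, by simpa using hS, ?_⟩
  rw [hfin.encard_eq_coe_toFinset_card] at hN
  exact Nat.lt_succ_iff.1 (by exact_mod_cast hN)

/-- Pigeonhole: if the packing number at scale `δ` is much larger than the covering number at scale
`C δ`, then some ball of radius `C δ` contains many `δ`-separated points, and among these many on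
which a given `1`-Lipschitz function varies by at most `δ / 2`. -/
lemma exists_local_packing {X : Type*} [PseudoMetricSpace X] {φ : X → ℝ} (hφ : LipschitzWith 1 φ)
    {A : Set X} {δ C : ℝ≥0} (hδ : 0 < δ) {B q N : ℕ} (hB : 2 * C ≤ B)
    (hpack : ((N * (2 * B + 1) * q : ℕ) : ℕ∞) < Metric.packingNumber δ A)
    (hcov : Metric.externalCoveringNumber (C * δ) A ≤ N) :
    ∃ F : Finset X, ↑F ⊆ A ∧ q < F.card ∧ ∀ u ∈ F, ∀ v ∈ F,
      (u ≠ v → δ < dist u v) ∧ dist u v ≤ 2 * C * δ ∧ |φ u - φ v| ≤ δ / 2 := by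
  classical
  have hδ' : (0 : ℝ) < δ := hδ
  obtain ⟨P, hPA, hPsep, hPcard⟩ := exists_finset_isSeparated hpack
  obtain ⟨Z, hZ, hZcard⟩ := exists_finset_isCover hcov
  have hcenter : ∀ u : X, ∃ z : X, u ∈ P → z ∈ Z ∧ dist u z ≤ C * δ := by
    intro u
    by_cases hu : u ∈ P
    · obtain ⟨z, hz, hd⟩ := hZ (hPA hu)
      refine ⟨z, fun _ => ⟨hz, ?_⟩⟩
      have : edist u z ≤ ((C * δ : ℝ≥0) : ℝ≥0∞) := hd
      rw [edist_nndist, ENNReal.coe_le_coe] at this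
      exact_mod_cast this
    · exact ⟨u, fun h => absurd h hu⟩
  choose z hz using hcenter
  -- The position of `φ u` relative to its value at the centre `z u`, in units of `δ / 2`.
  set bin : X → ℤ := fun u => ⌊(φ u - φ (z u)) / (δ / 2)⌋ with hbin
  have hlip : ∀ u v, |φ u - φ v| ≤ dist u v := fun u v => by
    simpa [Real.dist_eq] using hφ.dist_le_mul u v
  have hB' : 2 * (C : ℝ) ≤ B := by exact_mod_cast hB
  have hmaps : ∀ u ∈ P, (z u, bin u) ∈ Z ×ˢ Finset.Icc (-(B : ℤ)) B := by
    intro u hu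
    have h1 := abs_le.1 ((hlip u (z u)).trans (hz u hu).2)
    refine Finset.mem_product.2 ⟨(hz u hu).1, Finset.mem_Icc.2 ⟨?_, ?_⟩⟩
    · refine Int.le_floor.2 ?_
      rw [le_div_iff₀ (by positivity)]
      push_cast
      nlinarith [h1.1]
    · have : (bin u : ℝ) ≤ B := by
        refine (Int.floor_le _).trans ?_
        rw [div_le_iff₀ (by positivity)]
        nlinarith [h1.2]
      exact_mod_cast this
  have hcard : (Z ×ˢ Finset.Icc (-(B : ℤ)) B).card * q < P.card := by
    rw [Finset.card_product, Int.card_Icc, hPcard]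
    have : ((B : ℤ) + 1 - -(B : ℤ)).toNat = 2 * B + 1 := by omega
    rw [this]
    exact Nat.lt_succ_of_le (by gcongr)
  obtain ⟨⟨z₀, b⟩, -, hq⟩ := Finset.exists_lt_card_fiber_of_mul_lt_card_of_maps_to hmaps hcard
  refine ⟨_, ?_, hq, ?_⟩
  · exact fun u hu => hPA (Finset.mem_filter.1 hu).1
  intro u hu v hv
  obtain ⟨huP, hu'⟩ := Finset.mem_filter.1 hu
  obtain ⟨hvP, hv'⟩ := Finset.mem_filter.1 hv
  obtain ⟨hzu, hbu⟩ := Prod.mk.inj hu'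
  obtain ⟨hzv, hbv⟩ := Prod.mk.inj hv'
  refine ⟨fun huv => ?_, ?_, ?_⟩
  · have : (δ : ℝ≥0∞) < edist u v := hPsep huP hvP huv
    rw [edist_nndist, ENNReal.coe_lt_coe] at this
    exact_mod_cast this
  · have h1 := (hz u huP).2
    have h2 := (hz v hvP).2
    rw [hzu] at h1
    rw [hzv] at h2
    linarith [dist_triangle_right u v z₀]
  · have h1 := Int.abs_sub_lt_one_of_floor_eq_floor
      (a := (φ u - φ (z u)) / (δ / 2)) (b := (φ v - φ (z v)) / (δ / 2)) (hbu.trans hbv.symm)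
    rw [hzu, hzv, ← sub_div, abs_div, abs_of_pos (by positivity : (0 : ℝ) < δ / 2),
      div_lt_one (by positivity)] at h1
    rw [sub_sub_sub_cancel_right] at h1
    exact h1.le

lemma lt_of_coe_le_log {y : ℝ} {m : ℕ} {N : ℕ∞} (h : (y : EReal) ≤ ENNReal.log (N : ℝ≥0∞))
    (hm : (m : ℝ) < Real.exp y) : (m : ℕ∞) < N := by
  rw [← Real.log_exp y, ← ENNReal.log_ofReal_of_pos (Real.exp_pos y), ENNReal.log_le_log_iff] at h
  rw [← ENat.toENNReal_lt]
  refine lt_of_lt_of_le ?_ h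
  simpa [← ENNReal.ofReal_natCast] using (ENNReal.ofReal_lt_ofReal_iff (Real.exp_pos y)).2 hm

lemma le_floor_exp_of_log_le {y : ℝ} {N : ℕ∞} (h : ENNReal.log (N : ℝ≥0∞) ≤ (y : EReal)) :
    N ≤ (⌊Real.exp y⌋₊ : ℕ) := by
  rw [← Real.log_exp y, ← ENNReal.log_ofReal_of_pos (Real.exp_pos y), ENNReal.log_le_log_iff] at h
  induction N using ENat.recTopCoe with
  | top => simp at h
  | coe k =>
    have : (k : ℝ) ≤ Real.exp y := by
      rw [ENat.toENNReal_coe, ← ENNReal.ofReal_natCast] at h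
      exact (ENNReal.ofReal_le_ofReal_iff (Real.exp_pos y).le).1 h
    exact_mod_cast Nat.le_floor this

lemma exists_forall_le_rpow_neg {w : ℝ} (hw : 0 < w) (R : ℝ) :
    ∃ δ₀ : ℝ, 0 < δ₀ ∧ δ₀ ≤ 1 ∧ ∀ δ : ℝ, 0 < δ → δ ≤ δ₀ → R ≤ δ ^ (-w) := by
  have h1 : (1 : ℝ) ≤ max R 1 := le_max_right _ _
  refine ⟨(max R 1) ^ (-1 / w), by positivity, ?_, fun δ h0 hδ => ?_⟩
  · exact Real.rpow_le_one_of_one_le_of_nonpos h1 (by rw [neg_div]; simp; positivity)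
  · have h2 : ((max R 1) ^ (-1 / w)) ^ (-w) ≤ δ ^ (-w) :=
      Real.rpow_le_rpow_of_nonpos h0 hδ (by linarith)
    rw [← Real.rpow_mul (by positivity), show -1 / w * -w = 1 by field_simp, Real.rpow_one] at h2
    exact (le_max_left _ _).trans h2

section

variable {Ω : Type*} [MeasurableSpace Ω] {P : Measure Ω} [IsProbabilityMeasure P]

lemma dist_sq_eq_variance_add (u v : Lp ℝ 2 P) :
    dist u v ^ 2 = Var[fun t => u t - v t; P] + ((∫ t, u t ∂P) - ∫ t, v t ∂P) ^ 2 := by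
  have hu := Lp.memLp u
  have hv := Lp.memLp v
  have hsub : MemLp (fun t => u t - v t) 2 P := hu.sub hv
  have h1 : dist u v ^ 2 = ∫ t, (u t - v t) ^ 2 ∂P := by
    rw [dist_eq_norm, ← real_inner_self_eq_norm_sq, L2.inner_def]
    refine integral_congr_ae ?_
    filter_upwards [Lp.coeFn_sub u v] with t ht
    rw [real_inner_self_eq_norm_sq, ht]
    simp
  rw [variance_eq_sub hsub, h1, ← integral_sub (hu.integrable (by norm_num))
    (hv.integrable (by norm_num))]
  simp

lemma lipschitzWith_integral : LipschitzWith 1 fun u : Lp ℝ 2 P => ∫ t, u t ∂P := by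
  refine LipschitzWith.of_dist_le_mul fun u v => ?_
  rw [Real.dist_eq, NNReal.coe_one, one_mul]
  refine abs_le_of_sq_le_sq ?_ dist_nonneg
  rw [dist_sq_eq_variance_add]
  linarith [variance_nonneg (fun t => u t - v t) P]

end

/-- At every small scale `δ` the class contains exponentially many centred functions `g i`, with
measurable representatives `γ i`, at pairwise `L²` distances of order exactly `δ`. As the functions
are centred, the squared distances are the variances of the differences. -/
lemma exists_centered_packing {w K₁ K₂ : ℝ} (hw : 0 < w) (hK₁ : 0 < K₁) (hK₂ : 0 < K₂) :
    ∃ δ₀ C κ : ℝ, 0 < δ₀ ∧ 0 < C ∧ 0 < κ ∧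
      ∀ (k : ℕ) (V : Submodule ℝ (unitInterval → ℝ)) (J : Seminorm ℝ V),
        NullPolynomials k V J → MatchingEntropy w K₁ K₂ V J → ∀ δ : ℝ, 0 < δ → δ ≤ δ₀ →
        ∃ (m : ℕ) (g : Fin m → V) (γ : Fin m → unitInterval → ℝ), κ * δ ^ (-w) ≤ Real.log m ∧
          (∀ i, J (g i) ≤ 1 ∧ (g i : unitInterval → ℝ) =ᵐ[volume] γ i ∧ Measurable (γ i) ∧
            MemLp (γ i) 2 volume ∧ ∫ t, γ i t = 0) ∧
          ∀ i j, (i ≠ j → δ ^ 2 / 2 ≤ Var[fun t => γ i t - γ j t]) ∧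
            Var[fun t => γ i t - γ j t] ≤ (C * δ) ^ 2 := by
  -- With this `C` the covering number at scale `C δ` is at most the square root of the lower bound
  -- on the packing number at scale `δ`.
  set C : ℝ := (2 * K₂ / K₁) ^ (1 / w) with hC
  have hCpos : 0 < C := by positivity
  have hCw : K₂ * C ^ (-w) = K₁ / 2 := by
    rw [hC, ← Real.rpow_mul (by positivity), show 1 / w * -w = -1 by field_simp,
      Real.rpow_neg_one]
    field_simp
  set B : ℕ := ⌈2 * C⌉₊ with hBdef
  obtain ⟨δ₀, hδ₀, hδ₀1, hR⟩ := exists_forall_le_rpow_neg hw ((Real.log (2 * B + 1) + 1) * 4 / K₁)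
  refine ⟨δ₀, 2 * C, K₁ / 4, hδ₀, by positivity, by positivity, ?_⟩
  intro k V J hV hent δ hδ hδle
  set x := δ ^ (-w) with hx
  have hxR : Real.log (2 * B + 1) < K₁ / 4 * x := by
    have := hR δ hδ hδle
    rw [div_le_iff₀ hK₁] at this
    linarith
  set D : ℝ≥0 := ⟨δ, hδ.le⟩
  set C' : ℝ≥0 := ⟨C, hCpos.le⟩
  set q := ⌊Real.exp (K₁ / 4 * x)⌋₊ with hq
  set N := ⌊Real.exp (K₁ / 2 * x)⌋₊ with hN
  have hpack := hent.1 D hδ (hδle.trans hδ₀1)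
  have hcov := hent.2 (C' * D) (mul_pos hCpos hδ)
  have hexp : K₂ * ((C' * D : ℝ≥0) : ℝ) ^ (-w) = K₁ / 2 * x := by
    change K₂ * (C * δ) ^ (-w) = _
    rw [Real.mul_rpow hCpos.le hδ.le, ← hCw, mul_assoc]
  rw [hexp] at hcov
  have hm : ((N * (2 * B + 1) * q : ℕ) : ℝ) < Real.exp (K₁ * x) := by
    have h1 : (N : ℝ) ≤ Real.exp (K₁ / 2 * x) := Nat.floor_le (Real.exp_pos _).le
    have h2 : (q : ℝ) ≤ Real.exp (K₁ / 4 * x) := Nat.floor_le (Real.exp_pos _).le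
    have h3 : (2 * B + 1 : ℝ) < Real.exp (K₁ / 4 * x) :=
      (Real.log_lt_iff_lt_exp (by positivity)).1 hxR
    have h4 : Real.exp (K₁ * x) =
        Real.exp (K₁ / 2 * x) * Real.exp (K₁ / 4 * x) * Real.exp (K₁ / 4 * x) := by
      rw [← Real.exp_add, ← Real.exp_add]; ring_nf
    rw [h4]
    push_cast
    calc (N : ℝ) * (2 * B + 1) * q
        ≤ Real.exp (K₁ / 2 * x) * (2 * B + 1) * Real.exp (K₁ / 4 * x) := by gcongr
      _ < _ := by gcongr
  have hB : 2 * C' ≤ B := by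
    have : 2 * C ≤ B := Nat.le_ceil _
    exact_mod_cast this
  obtain ⟨F, hFA, hFq, hF⟩ := exists_local_packing
    (lipschitzWith_integral (P := (volume : Measure unitInterval)))
    (A := unitBall V J) (δ := D) (C := C') hδ hB (lt_of_coe_le_log hpack hm)
    (le_floor_exp_of_log_le hcov)
  obtain ⟨h1V, hJ1⟩ := hV.2 0 (Nat.zero_le k)
  set one : V := ⟨fun t : unitInterval => (t : ℝ) ^ 0, h1V⟩
  set u : Fin F.card → Lp ℝ 2 (volume : Measure unitInterval) := fun i => F.equivFin.symm i
  have hu : ∀ i, u i ∈ F := fun i => (F.equivFin.symm i).2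
  have huinj : Function.Injective u := Subtype.val_injective.comp F.equivFin.symm.injective
  choose g hgJ _ hgu using fun i => hFA (hu i)
  have hLp : ∀ i, MemLp (u i) 2 volume := fun i => Lp.memLp (u i)
  have hvar : ∀ i j, Var[fun t => (u i t - ∫ s, u i s) - (u j t - ∫ s, u j s)] =
      Var[fun t => u i t - u j t] := by
    intro i j
    have hm : AEStronglyMeasurable (fun t => u i t - u j t) volume :=
      ((hLp i).sub (hLp j)).aestronglyMeasurable
    rw [← variance_sub_const hm ((∫ s, u i s) - ∫ s, u j s)]
    congr 1
    ext t
    ring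
  refine ⟨F.card, fun i => g i - (∫ s, u i s) • one, fun i t => u i t - ∫ s, u i s, ?_, ?_, ?_⟩
  · rw [Real.le_log_iff_exp_le (by exact_mod_cast (Nat.zero_le _).trans_lt hFq)]
    exact (Nat.lt_floor_add_one _).le.trans (by exact_mod_cast hFq)
  · intro i
    refine ⟨?_, ?_, (Lp.stronglyMeasurable (u i)).measurable.sub_const _,
      (hLp i).sub (memLp_const _), ?_⟩
    · refine (map_sub_le_add J _ _).trans ?_
      rw [map_smul_eq_mul, hJ1, mul_zero, add_zero]
      exact hgJ i
    · filter_upwards [hgu i] with t ht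
      simp [one, ht]
    · rw [integral_sub ((hLp i).integrable (by norm_num)) (integrable_const _)]
      simp
  · intro i j
    obtain ⟨hsep, hdist, hmean⟩ := hF (u i) (hu i) (u j) (hu j)
    rw [hvar]
    have hd := dist_sq_eq_variance_add (u i) (u j)
    have hDδ : (D : ℝ) = δ := rfl
    have hCC : (C' : ℝ) = C := rfl
    rw [hDδ] at hsep hdist hmean
    rw [hCC] at hdist
    refine ⟨fun hij => ?_, ?_⟩
    · have h1 := hsep (huinj.ne hij)
      have h2 : δ ^ 2 ≤ dist (u i) (u j) ^ 2 := by gcongr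
      have h3 := sq_le_sq' (abs_le.1 hmean).1 (abs_le.1 hmean).2
      nlinarith
    · have h2 : dist (u i) (u j) ^ 2 ≤ (2 * C * δ) ^ 2 := by gcongr
      nlinarith [sq_nonneg ((∫ t, u i t) - ∫ t, u j t)]

/-! ### Codes over large alphabets -/

lemma card_hammingDist_lt_le {d M : ℕ} (hM : 1 ≤ M) (a : Fin d → Fin M) :
    (Finset.univ.filter fun b : Fin d → Fin M => 2 * hammingDist b a < d).card ^ 2
      ≤ 4 ^ d * M ^ d := by
  classical
  have hsub : (Finset.univ.filter fun b : Fin d → Fin M => 2 * hammingDist b a < d) ⊆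
      (Finset.univ.filter fun S : Finset (Fin d) => 2 * S.card < d).biUnion fun S =>
        Finset.univ.image fun r : S → Fin M => fun j => if h : j ∈ S then r ⟨j, h⟩ else a j := by
    intro b hb
    rw [Finset.mem_filter] at hb
    refine Finset.mem_biUnion.2 ⟨Finset.univ.filter fun j => b j ≠ a j, ?_, ?_⟩
    · simpa [hammingDist] using hb.2
    · refine Finset.mem_image.2 ⟨fun j => b j, Finset.mem_univ _, ?_⟩
      ext j
      by_cases h : b j = a j <;> simp [h]
  have h1 : (Finset.univ.filter fun b : Fin d → Fin M => 2 * hammingDist b a < d).card ≤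
      ∑ S ∈ Finset.univ.filter fun S : Finset (Fin d) => 2 * S.card < d, M ^ S.card := by
    refine (Finset.card_le_card hsub).trans (Finset.card_biUnion_le.trans ?_)
    refine Finset.sum_le_sum fun S _ => Finset.card_image_le.trans ?_
    simp
  have h2 : ∑ S ∈ Finset.univ.filter fun S : Finset (Fin d) => 2 * S.card < d, M ^ S.card ≤
      2 ^ d * M ^ ((d - 1) / 2) := by
    refine (Finset.sum_le_card_nsmul _ _ (M ^ ((d - 1) / 2)) fun S hS => ?_).trans ?_
    · rw [Finset.mem_filter] at hS
      exact Nat.pow_le_pow_right hM (by omega)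
    · rw [smul_eq_mul]
      gcongr
      exact (Finset.card_le_univ _).trans (by simp)
  calc _ ≤ (2 ^ d * M ^ ((d - 1) / 2)) ^ 2 := by gcongr; exact h1.trans h2
    _ = 4 ^ d * M ^ ((d - 1) / 2 * 2) := by
      rw [mul_pow, ← pow_mul, ← pow_mul, mul_comm d 2, pow_mul]; norm_num
    _ ≤ 4 ^ d * M ^ d := 
      Nat.mul_le_mul_left _ (Nat.pow_le_pow_right hM (by omega))

/-- A Gilbert–Varshamov bound for codes over a large alphabet: the code contains at least
`M ^ (d / 4)` words of length `d`, any two of which differ in at least half of the letters. -/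
lemma exists_code {M : ℕ} (hM : 16 ≤ M) (d : ℕ) :
    ∃ T : Finset (Fin d → Fin M), M ^ d ≤ T.card ^ 4 ∧
      (T : Set (Fin d → Fin M)).Pairwise fun a b => d ≤ 2 * hammingDist a b := by
  classical
  set good := Finset.univ.filter fun T : Finset (Fin d → Fin M) =>
    (T : Set (Fin d → Fin M)).Pairwise fun a b => d ≤ 2 * hammingDist a b
  obtain ⟨T, hT, hmax⟩ := good.exists_max_image Finset.card ⟨∅, by simp [good]⟩
  have hTp : (T : Set (Fin d → Fin M)).Pairwise fun a b => d ≤ 2 * hammingDist a b :=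
    (Finset.mem_filter.1 hT).2
  refine ⟨T, ?_, hTp⟩
  set ball := fun a : Fin d → Fin M =>
    Finset.univ.filter fun b : Fin d → Fin M => 2 * hammingDist b a < d
  -- A code of maximal cardinality is within distance `< d / 2` of every other word.
  have hcover : (Finset.univ : Finset (Fin d → Fin M)) ⊆ T ∪ T.biUnion ball := by
    intro b _
    by_contra hb
    simp only [Finset.mem_union, Finset.mem_biUnion, not_or, not_exists, not_and, ball,
      Finset.mem_filter, Finset.mem_univ, true_and, not_lt] at hb
    have : insert b T ∈ good := by
      refine Finset.mem_filter.2 ⟨Finset.mem_univ _, ?_⟩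
      rw [Finset.coe_insert]
      refine hTp.insert fun a ha _ => ⟨hb.2 a ha, ?_⟩
      rw [hammingDist_comm]
      exact hb.2 a ha
    have := hmax _ this
    rw [Finset.card_insert_of_notMem hb.1] at this
    omega
  rcases Nat.eq_zero_or_pos d with rfl | hd
  · have : T.Nonempty := by
      by_contra h
      rw [Finset.not_nonempty_iff_eq_empty] at h
      simpa [h] using hcover (Finset.mem_univ (fun j => j.elim0))
    simpa using Nat.one_le_pow 4 _ this.card_pos
  have hcover' : (Finset.univ : Finset (Fin d → Fin M)) ⊆ T.biUnion ball := by
    refine hcover.trans (Finset.union_subset (fun a ha => ?_) subset_rfl)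
    exact Finset.mem_biUnion.2 ⟨a, ha, by simpa [ball] using hd⟩
  have h1 : M ^ d ≤ ∑ a ∈ T, (ball a).card := by
    have := (Finset.card_le_card hcover').trans Finset.card_biUnion_le
    simpa using this
  have h2 : (M ^ d) ^ 2 ≤ T.card ^ 2 * (4 ^ d * M ^ d) := by
    calc (M ^ d) ^ 2 ≤ (∑ a ∈ T, (ball a).card) ^ 2 := by gcongr
      _ ≤ T.card * ∑ a ∈ T, (ball a).card ^ 2 := sq_sum_le_card_mul_sum_sq
      _ ≤ T.card * ∑ a ∈ T, 4 ^ d * M ^ d := by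
        gcongr with a; exact card_hammingDist_lt_le (by omega) a
      _ = T.card ^ 2 * (4 ^ d * M ^ d) := by rw [Finset.sum_const, smul_eq_mul]; ring
  have hMd : 0 < M ^ d := by positivity
  have h3 : M ^ d ≤ T.card ^ 2 * 4 ^ d := by
    refine Nat.le_of_mul_le_mul_right (a := M ^ d) ?_ hMd
    calc M ^ d * M ^ d = (M ^ d) ^ 2 := (sq _).symm
      _ ≤ _ := h2
      _ = _ := by ring
  have h4 : 16 ^ d ≤ M ^ d := by gcongr
  refine Nat.le_of_mul_le_mul_right (a := M ^ d) ?_ hMd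
  calc M ^ d * M ^ d ≤ (T.card ^ 2 * 4 ^ d) * (T.card ^ 2 * 4 ^ d) := by gcongr
    _ = T.card ^ 4 * 16 ^ d := by
      rw [show (16 : ℕ) = 4 * 4 by norm_num, mul_pow]; ring
    _ ≤ T.card ^ 4 * M ^ d := by gcongr

/-! ### Additive functions and the minimax bound -/

lemma volume_preserving_coord {d : ℕ} (j : Fin d) :
    MeasurePreserving (fun x : Fin d → unitInterval => x j) volume volume :=
  measurePreserving_eval (fun _ : Fin d => (volume : Measure unitInterval)) j

lemma integral_sum_eval_eq_zero {d : ℕ} {η : Fin d → unitInterval → ℝ}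
    (hη : ∀ j, Integrable (η j) volume) (hη0 : ∀ j, ∫ t, η j t = 0) :
    ∫ x : Fin d → unitInterval, ∑ j, η j (x j) = 0 := by
  have hmp := fun j : Fin d => volume_preserving_coord j
  have hint : ∀ j, Integrable (fun x : Fin d → unitInterval => η j (x j)) volume := fun j =>
    (hmp j).integrable_comp_of_integrable (hη j)
  rw [integral_finsetSum _ fun j _ => hint j]
  refine Finset.sum_eq_zero fun j _ => ?_
  have h := integral_map (μ := (volume : Measure (Fin d → unitInterval)))
    (hmp j).measurable.aemeasurable (f := η j)
    (by rw [(hmp j).map_eq]; exact (hη j).aestronglyMeasurable)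
  rw [(hmp j).map_eq, hη0 j] at h
  exact h.symm

/-- Pythagoras: centred functions of distinct coordinates are orthogonal in `L²([0, 1] ^ d)`. -/
lemma lintegral_sq_sum_eval {d : ℕ} {η : Fin d → unitInterval → ℝ}
    (hη : ∀ j, MemLp (η j) 2 volume) (hη0 : ∀ j, ∫ t, η j t = 0) :
    ∫⁻ x : Fin d → unitInterval, ENNReal.ofReal ((∑ j, η j (x j)) ^ 2) =
      ENNReal.ofReal (∑ j, Var[η j]) := by
  have hmp := fun j : Fin d => volume_preserving_coord j
  have h0 := integral_sum_eval_eq_zero (fun j => (hη j).integrable (by norm_num)) hη0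
  have hsum : (∑ j, fun x : Fin d → unitInterval => η j (x j)) = fun x => ∑ j, η j (x j) := by
    ext x; simp
  have hLp : MemLp (fun x : Fin d → unitInterval => ∑ j, η j (x j)) 2 volume :=
    memLp_finsetSum _ fun j _ => (hη j).comp_measurePreserving (hmp j)
  have hvar := variance_sum_pi (μ := fun _ : Fin d => (volume : Measure unitInterval)) hη
  rw [hsum] at hvar
  change Var[fun x : Fin d → unitInterval => ∑ j, η j (x j); volume] = _ at hvar
  rw [← hvar, ofReal_variance hLp, evariance_eq_lintegral_ofReal]
  simp [h0]

lemma eLpNorm_two_sq {Ω : Type*} [MeasurableSpace Ω] {P : Measure Ω} (f : Ω → ℝ) :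
    eLpNorm f 2 P ^ 2 = ∫⁻ x, ENNReal.ofReal (f x ^ 2) ∂P := by
  have h := eLpNorm_nnreal_pow_eq_lintegral (μ := P) (f := f) (p := 2) two_ne_zero
  simp only [NNReal.coe_ofNat, ENNReal.rpow_ofNat, ENNReal.coe_ofNat] at h
  rw [h]
  refine lintegral_congr fun x => ?_
  rw [← enorm_pow, Real.enorm_of_nonneg (sq_nonneg _)]

lemma risk_congr {σ μ : ℝ} {d n : ℕ} (fhat : Estimator d n)
    {f f' : (Fin d → unitInterval) → ℝ} (h : f =ᵐ[volume] f') :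
    risk σ μ fhat f = risk σ μ fhat f' := by
  have h1 : ∀ᵐ X ∂(Measure.pi fun _ : Fin n => (volume : Measure (Fin d → unitInterval))),
      ∀ i, f (X i) = f' (X i) := by
    rw [ae_all_iff]
    exact fun i => (Measure.quasiMeasurePreserving_eval
      (fun _ : Fin n => (volume : Measure (Fin d → unitInterval))) i).ae h
  have h2 : ∀ᵐ p ∂(sampleLaw σ d n), ∀ i, f (p.1 i) = f' (p.1 i) :=
    Measure.quasiMeasurePreserving_fst.ae h1
  refine lintegral_congr_ae ?_
  filter_upwards [h2] with p hp
  have : response μ f p.1 p.2 = response μ f' p.1 p.2 := by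
    ext i; simp only [response, hp i]
  rw [this, eLpNorm_congr_ae (h.mono fun x hx => by rw [hx])]

/-- The minimax lower bound in terms of the scale `δ`: a packing of the class of one-dimensional
functions at scale `δ` is used in every coordinate, scaled by `c`. -/
lemma le_minimaxRisk_of_packing {σ : ℝ} (hσ : 0 < σ) (μ : ℝ) {V : Submodule ℝ (unitInterval → ℝ)}
    {J : Seminorm ℝ V} {d n m : ℕ} (hd : 1 ≤ d) {c δ C ℓ : ℝ} (hc : 0 < c) (hδ : 0 < δ)
    {g : Fin m → V} {γ : Fin m → unitInterval → ℝ} (hJ : ∀ i, J (g i) ≤ 1)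
    (hγ : ∀ i, (g i : unitInterval → ℝ) =ᵐ[volume] γ i) (hγm : ∀ i, Measurable (γ i))
    (hγL : ∀ i, MemLp (γ i) 2 volume) (hγ0 : ∀ i, ∫ t, γ i t = 0)
    (hlow : ∀ i j, i ≠ j → δ ^ 2 / 2 ≤ Var[fun t => γ i t - γ j t])
    (hup : ∀ i j, Var[fun t => γ i t - γ j t] ≤ (C * δ) ^ 2)
    (hm : ℓ ≤ Real.log m) (hℓ : 4 * Real.log 4096 ≤ ℓ)
    (hKL : 64 * n * (c * (C * δ)) ^ 2 / σ ^ 2 ≤ ℓ) :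
    ENNReal.ofReal (d * (c * δ) ^ 2 / 32) ≤ minimaxRisk σ μ d n (centeredClass V J d c) := by
  have hd1 : (1 : ℝ) ≤ d := by exact_mod_cast hd
  have hlog0 : 0 < Real.log 4096 := Real.log_pos (by norm_num)
  have hm0 : (0 : ℝ) < m := by
    have : m ≠ 0 := by
      rintro rfl
      simp only [Nat.cast_zero, Real.log_zero] at hm
      linarith
    positivity
  have hm16 : 16 ≤ m := by
    have h1 : Real.log 16 ≤ Real.log m :=
      (Real.log_le_log (by norm_num) (by norm_num : (16 : ℝ) ≤ 4096)).trans (by linarith)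
    exact_mod_cast (Real.log_le_log_iff (by norm_num) hm0).1 h1
  obtain ⟨T, hTcard, hTsep⟩ := exists_code hm16 d
  have hT0 : (0 : ℝ) < T.card := by
    have : T.card ≠ 0 := by
      intro h
      rw [h] at hTcard
      have : 0 < m ^ d := by positivity
      simp at hTcard
      omega
    positivity
  have hTlog : d * ℓ / 4 ≤ Real.log T.card := by
    have h1 : Real.log ((m : ℝ) ^ d) ≤ Real.log ((T.card : ℝ) ^ 4) :=
      Real.log_le_log (by positivity) (by exact_mod_cast hTcard)
    rw [Real.log_pow, Real.log_pow] at h1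
    push_cast at h1
    nlinarith
  have hT4096 : 4096 ≤ Fintype.card T := by
    rw [Fintype.card_coe]
    have h1 : Real.log 4096 ≤ Real.log T.card := by nlinarith
    exact_mod_cast (Real.log_le_log_iff (by norm_num) hT0).1 h1
  set f : T → (Fin d → unitInterval) → ℝ := fun θ x => ∑ j, c * γ (θ.1 j) (x j) with hf
  have hfm : ∀ θ, Measurable (f θ) := fun θ => Finset.measurable_sum _ fun j _ =>
    ((hγm _).comp (measurable_pi_apply j)).const_mul c
  have hdist : ∀ θ θ' : T, ∫⁻ x, ENNReal.ofReal ((f θ x - f θ' x) ^ 2) =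
      ENNReal.ofReal (∑ j, c ^ 2 * Var[fun t => γ (θ.1 j) t - γ (θ'.1 j) t]) := by
    intro θ θ'
    have h1 := lintegral_sq_sum_eval
      (η := fun j t => c * (γ (θ.1 j) t - γ (θ'.1 j) t))
      (fun j => ((hγL _).sub (hγL _)).const_mul c) (fun j => by
        rw [integral_const_mul, integral_sub ((hγL _).integrable (by norm_num))
          ((hγL _).integrable (by norm_num)), hγ0, hγ0, sub_zero, mul_zero])
    simp only [variance_const_mul] at h1
    rw [← h1]
    refine lintegral_congr fun x => ?_
    simp only [hf, ← Finset.sum_sub_distrib, mul_sub]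
  have hsep : Pairwise fun θ θ' : T =>
      ENNReal.ofReal (Real.sqrt (d * (c * δ) ^ 2 / 4)) ≤
        eLpNorm (fun x => f θ x - f θ' x) 2 volume := by
    intro θ θ' hne
    rw [← ENNReal.pow_le_pow_left_iff two_ne_zero, eLpNorm_two_sq, hdist,
      ← ENNReal.ofReal_pow (Real.sqrt_nonneg _), Real.sq_sqrt (by positivity)]
    refine ENNReal.ofReal_le_ofReal ?_
    have hham : d ≤ 2 * hammingDist θ.1 θ'.1 :=
      hTsep θ.2 θ'.2 (fun h => hne (Subtype.ext h))
    have hham' : (d : ℝ) ≤ 2 * hammingDist θ.1 θ'.1 := by exact_mod_cast hham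
    calc d * (c * δ) ^ 2 / 4 ≤ hammingDist θ.1 θ'.1 * (c ^ 2 * (δ ^ 2 / 2)) := by
          have : 0 ≤ (c * δ) ^ 2 := by positivity
          nlinarith
      _ = ∑ j ∈ Finset.univ.filter fun j => θ.1 j ≠ θ'.1 j, c ^ 2 * (δ ^ 2 / 2) := by
          rw [Finset.sum_const, nsmul_eq_mul]; rfl
      _ ≤ ∑ j ∈ Finset.univ.filter fun j => θ.1 j ≠ θ'.1 j,
            c ^ 2 * Var[fun t => γ (θ.1 j) t - γ (θ'.1 j) t] := by
          refine Finset.sum_le_sum fun j hj => ?_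
          gcongr
          exact hlow _ _ (Finset.mem_filter.1 hj).2
      _ ≤ _ := Finset.sum_le_univ_sum_of_nonneg fun j =>
          mul_nonneg (sq_nonneg c) (variance_nonneg _ _)
  obtain ⟨θ₀⟩ : Nonempty T := Fintype.card_pos_iff.1 (by omega)
  have hH : ∀ θ, ∫⁻ x, ENNReal.ofReal ((f θ x - f θ₀ x) ^ 2) ≤
      ENNReal.ofReal (d * (c * (C * δ)) ^ 2) := by
    intro θ
    rw [hdist]
    refine ENNReal.ofReal_le_ofReal ?_
    calc _ ≤ ∑ _j : Fin d, c ^ 2 * (C * δ) ^ 2 := by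
          refine Finset.sum_le_sum fun j _ => ?_
          gcongr
          exact hup _ _
      _ = _ := by
          rw [Finset.sum_const, Finset.card_univ, Fintype.card_fin, nsmul_eq_mul, mul_pow c]
  have hfano : 16 * n * (d * (c * (C * δ)) ^ 2) / σ ^ 2 ≤ Real.log (Fintype.card T) := by
    rw [Fintype.card_coe]
    refine le_trans ?_ hTlog
    rw [show 16 * n * (d * (c * (C * δ)) ^ 2) / σ ^ 2 =
      d * (64 * n * (c * (C * δ)) ^ 2 / σ ^ 2) / 4 by ring]
    gcongr
  refine le_iInf₂ fun fhat hfhat => ?_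
  obtain ⟨θ, hθ⟩ := exists_le_risk hσ μ hfm θ₀ hsep hH hT4096 hfano hfhat
  have hconst : (ENNReal.ofReal (Real.sqrt (d * (c * δ) ^ 2 / 4)) / 2) ^ 2 / 2 =
      ENNReal.ofReal (d * (c * δ) ^ 2 / 32) := by
    rw [← ENNReal.ofReal_ofNat 2, ← ENNReal.ofReal_div_of_pos two_pos,
      ← ENNReal.ofReal_pow (by positivity), ← ENNReal.ofReal_div_of_pos two_pos, div_pow,
      Real.sq_sqrt (by positivity)]
    congr 1
    ring
  rw [hconst] at hθ
  set F : (Fin d → unitInterval) → ℝ :=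
    fun x => ∑ j, ((c • g (θ.1 j) : V) : unitInterval → ℝ) (x j) with hF
  have hFf : F =ᵐ[volume] f θ := by
    have h1 : ∀ᵐ x : Fin d → unitInterval, ∀ j,
        (g (θ.1 j) : unitInterval → ℝ) (x j) = γ (θ.1 j) (x j) := by
      rw [ae_all_iff]
      exact fun j => (volume_preserving_coord j).quasiMeasurePreserving.ae (hγ (θ.1 j))
    filter_upwards [h1] with x hx
    refine Finset.sum_congr rfl fun j _ => ?_
    rw [← hx j]
    rfl
  have hFmem : F ∈ centeredClass V J d c := by
    refine ⟨⟨fun j => c • g (θ.1 j), fun j => ?_, rfl⟩, ?_⟩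
    · rw [map_smul_eq_mul, Real.norm_of_nonneg hc.le]
      exact mul_le_of_le_one_right hc.le (hJ _)
    · rw [integral_congr_ae hFf]
      refine integral_sum_eval_eq_zero
        (fun j => ((hγL _).integrable (by norm_num)).const_mul c) fun j => ?_
      rw [integral_const_mul, hγ0, mul_zero]
  rw [← risk_congr fhat hFf] at hθ
  exact hθ.trans (le_iSup₂ (f := fun f (_ : f ∈ centeredClass V J d c) => risk σ μ fhat f) F hFmem)

end AdditiveMinimax

theorem theorem3 (σ : ℝ) (hσ : 0 < σ) (k : ℕ) (L : ℝ) (hL : 0 < L)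
    (w : ℝ) (hw0 : 0 < w) (hw2 : w < 2) (K₁ K₂ : ℝ) (hK₁ : 0 < K₁) (hK₂ : 0 < K₂) :
    ∃ c₀ n₀ : ℝ, 0 < c₀ ∧ 0 < n₀ ∧
      ∀ (V : Submodule ℝ (unitInterval → ℝ)) (J : Seminorm ℝ V),
        AdditiveMinimax.NullPolynomials k V J →
        AdditiveMinimax.BoundedDerivs k L V J →
        AdditiveMinimax.MatchingEntropy w K₁ K₂ V J →
        ∀ (d n : ℕ) (c μ : ℝ), 1 ≤ d → 1 ≤ c →
          n₀ * (d : ℝ) ^ (1 + w / 2) * c ^ w ≤ (n : ℝ) →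
          ENNReal.ofReal (c₀ * (d : ℝ) * (n : ℝ) ^ (-2 / (2 + w)) * c ^ (2 * w / (2 + w)))
            ≤ AdditiveMinimax.minimaxRisk σ μ d n (AdditiveMinimax.centeredClass V J d c) := by
  obtain ⟨δ₀, C, κ, hδ₀, hC, hκ, hpack⟩ :=
    AdditiveMinimax.exists_centered_packing hw0 hK₁ hK₂
  obtain ⟨δ₁, hδ₁, -, hR⟩ :=
    AdditiveMinimax.exists_forall_le_rpow_neg hw0 (4 * Real.log 4096 / κ)
  -- The scale solves `64 n (c C δ) ^ 2 / σ ^ 2 = κ δ ^ (-w)`, that is, `n c ^ 2 δ ^ (2 + w) = A`.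
  set A := κ * σ ^ 2 / (64 * C ^ 2) with hA
  have hApos : 0 < A := by positivity
  have h2w : 0 < 2 + w := by linarith
  have hmin : 0 < min δ₀ δ₁ := lt_min hδ₀ hδ₁
  refine ⟨A ^ (2 / (2 + w)) / 32, A / min δ₀ δ₁ ^ (2 + w), by positivity, by positivity, ?_⟩
  intro V J hV _ hent d n c μ hd hc hn
  have hc0 : 0 < c := by linarith
  have hd1 : (1 : ℝ) ≤ d := by exact_mod_cast hd
  have hn₀ : A / min δ₀ δ₁ ^ (2 + w) ≤ n := by
    refine le_trans ?_ hn
    rw [mul_assoc]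
    refine le_mul_of_one_le_right (by positivity) ?_
    exact one_le_mul_of_one_le_of_one_le (Real.one_le_rpow hd1 (by positivity))
      (Real.one_le_rpow hc hw0.le)
  have hnpos : (0 : ℝ) < n := lt_of_lt_of_le (by positivity) hn₀
  set δ := (A / (n * c ^ 2)) ^ (1 / (2 + w)) with hδdef
  have hδ : 0 < δ := by positivity
  have hδpow : δ ^ (2 + w) = A / (n * c ^ 2) := by
    rw [hδdef, ← Real.rpow_mul (by positivity), one_div_mul_cancel h2w.ne', Real.rpow_one]
  have hδle : δ ≤ min δ₀ δ₁ := by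
    rw [← Real.rpow_le_rpow_iff hδ.le hmin.le h2w, hδpow, div_le_iff₀ (by positivity)]
    rw [div_le_iff₀ (by positivity)] at hn₀
    have h1 : (1 : ℝ) ≤ c ^ 2 := one_le_pow₀ hc
    have h2 : 0 < (n : ℝ) * min δ₀ δ₁ ^ (2 + w) := by positivity
    nlinarith
  have hδsq : δ ^ 2 = A ^ (2 / (2 + w)) * (n : ℝ) ^ (-2 / (2 + w)) * c ^ (-4 / (2 + w)) := by
    rw [hδdef, ← Real.rpow_natCast, ← Real.rpow_mul (by positivity),
      Real.div_rpow hApos.le (by positivity), Real.mul_rpow hnpos.le (by positivity),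
      ← Real.rpow_natCast c, ← Real.rpow_mul hc0.le, neg_div, neg_div, Real.rpow_neg hnpos.le,
      Real.rpow_neg hc0.le]
    push_cast
    rw [show 1 / (2 + w) * 2 = 2 / (2 + w) by ring, show 2 * (2 / (2 + w)) = 4 / (2 + w) by ring]
    field_simp
  have hcpow : c ^ 2 * c ^ (-4 / (2 + w)) = c ^ (2 * w / (2 + w)) := by
    rw [← Real.rpow_natCast, ← Real.rpow_add hc0]
    congr 1
    push_cast
    field_simp
    ring
  obtain ⟨m, g, γ, hm, hg, hvar⟩ := hpack k V J hV hent δ hδ (hδle.trans (min_le_left _ _))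
  have hℓ : 4 * Real.log 4096 ≤ κ * δ ^ (-w) := by
    have := hR δ hδ (hδle.trans (min_le_right _ _))
    rw [div_le_iff₀ hκ] at this
    linarith
  have hKL : 64 * n * (c * (C * δ)) ^ 2 / σ ^ 2 ≤ κ * δ ^ (-w) := by
    rw [Real.rpow_add hδ, Real.rpow_ofNat, eq_div_iff (by positivity), hA] at hδpow
    rw [Real.rpow_neg hδ.le, ← div_eq_mul_inv, div_le_div_iff₀ (by positivity) (by positivity)]
    rw [eq_div_iff (by positivity)] at hδpow
    refine le_of_eq ?_
    rw [← hδpow]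
    ring
  have h := AdditiveMinimax.le_minimaxRisk_of_packing hσ μ hd hc0 hδ (fun i => (hg i).1)
    (fun i => (hg i).2.1) (fun i => (hg i).2.2.1) (fun i => (hg i).2.2.2.1)
    (fun i => (hg i).2.2.2.2) (fun i j => (hvar i j).1) (fun i j => (hvar i j).2) hm hℓ hKL
  convert h using 2
  rw [mul_pow, hδsq, ← hcpow]
  ring
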